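/- Let $d\in\mathbb{N}$. For $j\in\mathbb{Z}$ and $m\in\mathbb{Z}^d$ let $Q_{j,m}=2^{-j}\bigl(m+[0,1)^d\bigr)$ be the usual dyadic cubes in $\mathbb{R}^d$, and let $|\cdot|$ denote Lebesgue measure. For $0<p\le u<\infty$ the Morrey sequence space $m_{u,p}(\mathbb{Z}^d)$ consists of all $\lambda=\{\lambda_k\}_{k\in\mathbb{Z}^d}\subset\mathbb{C}$ with $$\|\lambda\,|\,m_{u,p}\|=\sup_{j\in\mathbb{N}_0;\,m\in\mathbb{Z}^d}|Q_{-j,m}|^{\frac1u-\frac1p}\Bigl(\sum_{k:\,Q_{0,k}\subset Q_{-j,m}}|\lambda_k|^p\Bigr)^{\frac1p}<\infty,$$ and $m_{u,p}^{00}(\mathbb{Z}^d)$ denotes the closure in $m_{u,p}(\mathbb{Z}^d)$ of the set of finite sequences (those with only finitely many non-vanishing elements), equipped with the norm of $m_{u,p}(\mathbb{Z}^d)$. Theorem 4.2. Let $1<p<u<\infty$ and $1\le q<\infty$. Then every bounded linear operator $T$ from $m_{u,p}^{00}(\mathbb{Z}^d)$ into $\ell_q(\mathbb{Z}^d)$ (complex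 sequences) is compact. -/

import Mathlib

open MeasureTheory
open scoped ENNReal

noncomputable section

namespace MorreySequence

/-- The dyadic cube `Q_{j,m} = 2^{-j} (m + [0,1)^d)`, for `j : ℤ` and `m : ℤ^d`. -/
def dyadicCube {d : ℕ} (j : ℤ) (m : Fin d → ℤ) : Set (Fin d → ℝ) :=
  {x | ∀ i, (2 : ℝ) ^ (-j) * (m i : ℝ) ≤ x i ∧ x i < (2 : ℝ) ^ (-j) * ((m i : ℝ) + 1)}

/-- The indices `k : ℤ^d` with `Q_{0,k} ⊆ Q_{-j,m}`. -/
def cubeIndices {d : ℕ} (j : ℕ) (m : Fin d → ℤ) : Set (Fin d → ℤ) :=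
  {k | dyadicCube 0 k ⊆ dyadicCube (-(j : ℤ)) m}

/-- The term `|Q_{-j,m}|^{1/u - 1/p} (∑_{k : Q_{0,k} ⊆ Q_{-j,m}} |x_k|^p)^{1/p}`. -/
def cubeTerm {d : ℕ} (u p : ℝ) (x : (Fin d → ℤ) → ℂ) (j : ℕ) (m : Fin d → ℤ) : ℝ≥0∞ :=
  volume (dyadicCube (-(j : ℤ)) m) ^ (1 / u - 1 / p) *
    (∑' k : cubeIndices j m, ‖x k‖ₑ ^ p) ^ (1 / p)

/-- The Morrey norm of a sequence over `ℤ^d`, as an extended non-negative number. -/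
def morreyENorm {d : ℕ} (u p : ℝ) (x : (Fin d → ℤ) → ℂ) : ℝ≥0∞ :=
  ⨆ (j : ℕ) (m : Fin d → ℤ), cubeTerm u p x j m

/- The Morrey norm is a norm for `1 ≤ p`. -/

lemma cubeTerm_add_le {d : ℕ} (u : ℝ) {p : ℝ} (hp : 1 ≤ p) (x y : (Fin d → ℤ) → ℂ) (j : ℕ)
    (m : Fin d → ℤ) : cubeTerm u p (x + y) j m ≤ cubeTerm u p x j m + cubeTerm u p y j m := by
  unfold cubeTerm
  rw [← mul_add]
  gcongr
  let _ : MeasurableSpace (cubeIndices j m) := ⊤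
  have h := ENNReal.lintegral_Lp_add_le (μ := (Measure.count : Measure (cubeIndices j m)))
    (f := fun k => ‖x k‖ₑ) (g := fun k => ‖y k‖ₑ)
    (measurable_from_top.aemeasurable) (measurable_from_top.aemeasurable) hp
  simp only [lintegral_count, Pi.add_apply] at h
  refine le_trans ?_ h
  gcongr
  exact enorm_add_le _ _

lemma morreyENorm_add_le {d : ℕ} (u : ℝ) {p : ℝ} (hp : 1 ≤ p) (x y : (Fin d → ℤ) → ℂ) :
    morreyENorm u p (x + y) ≤ morreyENorm u p x + morreyENorm u p y := by
  refine iSup₂_le fun j m => (cubeTerm_add_le u hp x y j m).trans ?_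
  exact add_le_add (le_iSup₂ (f := fun j m => cubeTerm u p x j m) j m)
    (le_iSup₂ (f := fun j m => cubeTerm u p y j m) j m)

lemma morreyENorm_smul {d : ℕ} (u : ℝ) {p : ℝ} (hp : 1 ≤ p) (c : ℂ) (x : (Fin d → ℤ) → ℂ) :
    morreyENorm u p (c • x) = ‖c‖ₑ * morreyENorm u p x := by
  have hp0 : 0 < p := by linarith
  have key : ∀ j m, cubeTerm u p (c • x) j m = ‖c‖ₑ * cubeTerm u p x j m := by
    intro j m
    unfold cubeTerm
    simp only [Pi.smul_apply, enorm_smul, ENNReal.mul_rpow_of_nonneg _ _ hp0.le,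
      ENNReal.tsum_mul_left]
    rw [ENNReal.mul_rpow_of_nonneg _ _ (by positivity), ← ENNReal.rpow_mul,
      mul_one_div_cancel hp0.ne', ENNReal.rpow_one]
    ring
  simp only [morreyENorm, key, ENNReal.mul_iSup]

lemma morreyENorm_zero {d : ℕ} (u : ℝ) {p : ℝ} (hp : 1 ≤ p) :
    morreyENorm u p (0 : (Fin d → ℤ) → ℂ) = 0 := by
  simpa using morreyENorm_smul u hp 0 (0 : (Fin d → ℤ) → ℂ)

lemma enorm_le_morreyENorm {d : ℕ} (u : ℝ) {p : ℝ} (hp : 1 ≤ p) (x : (Fin d → ℤ) → ℂ)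
    (k : Fin d → ℤ) : ‖x k‖ₑ ≤ morreyENorm u p x := by
  have hp0 : 0 < p := by linarith
  refine le_trans ?_ (le_iSup₂ (f := fun j m => cubeTerm u p x j m) 0 k)
  have hv : volume (dyadicCube (-((0 : ℕ) : ℤ)) k) = 1 := by
    have : dyadicCube (-((0 : ℕ) : ℤ)) k
        = Set.univ.pi fun i => Set.Ico (k i : ℝ) ((k i : ℝ) + 1) := by
      ext z; simp [dyadicCube]
    rw [this, Real.volume_pi_Ico]; simp
  have hk : k ∈ cubeIndices 0 k := by simp [cubeIndices]
  unfold cubeTerm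
  rw [hv, ENNReal.one_rpow, one_mul]
  calc ‖x k‖ₑ = (‖x k‖ₑ ^ p) ^ (1 / p) := by
        rw [← ENNReal.rpow_mul, mul_one_div_cancel hp0.ne', ENNReal.rpow_one]
    _ ≤ _ := by
        gcongr
        exact ENNReal.le_tsum (f := fun k' : cubeIndices 0 k => ‖x k'‖ₑ ^ p) ⟨k, hk⟩

/-- The sequences with finite Morrey norm, as a linear subspace of all complex sequences. -/
def morreySubmodule (d : ℕ) (u p : ℝ) [hp : Fact (1 ≤ p)] : Submodule ℂ ((Fin d → ℤ) → ℂ) where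
  carrier := {x | morreyENorm u p x < ∞}
  add_mem' {x y} hx hy :=
    (morreyENorm_add_le u hp.out x y).trans_lt (ENNReal.add_lt_top.2 ⟨hx, hy⟩)
  zero_mem' := by simp [morreyENorm_zero u hp.out]
  smul_mem' c x hx := by
    simp only [Set.mem_ofPred_eq, morreyENorm_smul u hp.out] at hx ⊢
    exact ENNReal.mul_lt_top (by simp) hx

/-- The Morrey sequence space `m_{u,p}(ℤ^d)`. It is a type of its own, so that it carries the
topology of the Morrey norm and not that of pointwise convergence. -/
def MorreySpace (d : ℕ) (u p : ℝ) [Fact (1 ≤ p)] : Type := morreySubmodule d u p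

variable {d : ℕ} {u p : ℝ} [hp : Fact (1 ≤ p)]

instance : AddCommGroup (MorreySpace d u p) := inferInstanceAs (AddCommGroup (morreySubmodule d u p))

instance : Module ℂ (MorreySpace d u p) := inferInstanceAs (Module ℂ (morreySubmodule d u p))

/-- The underlying sequence of an element of the Morrey space. -/
def MorreySpace.toSeq : MorreySpace d u p →ₗ[ℂ] ((Fin d → ℤ) → ℂ) := (morreySubmodule d u p).subtype

lemma MorreySpace.toSeq_injective :
    Function.Injective (MorreySpace.toSeq : MorreySpace d u p → ((Fin d → ℤ) → ℂ)) :=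
  Subtype.val_injective

lemma MorreySpace.morreyENorm_lt_top (x : MorreySpace d u p) : morreyENorm u p x.toSeq < ∞ :=
  x.2

instance : Norm (MorreySpace d u p) := ⟨fun x => (morreyENorm u p x.toSeq).toReal⟩

lemma MorreySpace.norm_def (x : MorreySpace d u p) : ‖x‖ = (morreyENorm u p x.toSeq).toReal := rfl

lemma MorreySpace.normCore : NormedSpace.Core ℂ (MorreySpace d u p) where
  norm_nonneg _ := ENNReal.toReal_nonneg
  norm_smul c x := by
    simp [MorreySpace.norm_def, morreyENorm_smul u hp.out]
  norm_triangle x y := by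
    simp only [MorreySpace.norm_def, map_add]
    rw [← ENNReal.toReal_add x.morreyENorm_lt_top.ne y.morreyENorm_lt_top.ne]
    exact ENNReal.toReal_mono
      (ENNReal.add_ne_top.2 ⟨x.morreyENorm_lt_top.ne, y.morreyENorm_lt_top.ne⟩)
      (morreyENorm_add_le u hp.out _ _)
  norm_eq_zero_iff x := by
    constructor
    · intro h
      rw [MorreySpace.norm_def, ENNReal.toReal_eq_zero_iff] at h
      have h0 := h.resolve_right x.morreyENorm_lt_top.ne
      apply MorreySpace.toSeq_injective
      rw [map_zero]
      funext k
      have := enorm_le_morreyENorm u hp.out x.toSeq k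
      rw [h0] at this
      simpa using this
    · rintro rfl
      simp [MorreySpace.norm_def, morreyENorm_zero u hp.out]

instance : NormedAddCommGroup (MorreySpace d u p) :=
  NormedAddCommGroup.ofCore MorreySpace.normCore

instance : NormedSpace ℂ (MorreySpace d u p) := NormedSpace.ofCore MorreySpace.normCore

variable (d u p) in
/-- The finite sequences `c_00`, as a subspace of `m_{u,p}(ℤ^d)`. -/
def finiteSeq : Submodule ℂ (MorreySpace d u p) where
  carrier := {x | (Function.support x.toSeq).Finite}
  add_mem' {x y} hx hy := by
    simp only [Set.mem_ofPred_eq, map_add] at hx hy ⊢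
    exact (hx.union hy).subset (Function.support_add _ _)
  zero_mem' := by simp
  smul_mem' c x hx := by
    simp only [Set.mem_ofPred_eq, map_smul] at hx ⊢
    exact hx.subset (Function.support_const_smul_subset c _)

variable (d u p) in
/-- `m_{u,p}^{00}(ℤ^d)`: the closure of the finite sequences in `m_{u,p}(ℤ^d)`. It carries the
norm of `m_{u,p}(ℤ^d)`. -/
def closureFinite : Submodule ℂ (MorreySpace d u p) := (finiteSeq d u p).topologicalClosure

end MorreySequence

end

open Filter Topology

namespace MorreySequence

/-! ### Cubes and the Morrey norm of sequences -/

/-! `T` is approximated in operator norm by `T ∘L truncCLM hpu F`, which has finite rank, so it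
suffices that `T` is uniformly small on unit vectors supported off a large finite set `F`.

The source of this is a c₀-like property of the Morrey norm
(`exists_finset_morreyENorm_add_le_two`): since `p < u`, a finite sequence is negligible on large
cubes, so vectors of norm at most 1 supported far enough away can be added again and again without
leaving the ball of radius 2. In `ℓ_q` with `q < ∞` such sums must blow up. If `T` were not small on
tails, a gliding hump would first make each coordinate of `T x` small on tails (otherwise a
functional would grow linearly on the ball); then `T x` is almost disjoint from `T z`, and every
step adds at least `ε ^ q / 2` to `‖T z‖ ^ q`, contradicting boundedness. -/

lemma volume_dyadicCube {d : ℕ} (j : ℕ) (m : Fin d → ℤ) :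
    volume (dyadicCube (-(j : ℤ)) m) = ((2 : ℝ≥0∞) ^ j) ^ d := by
  have : dyadicCube (-(j : ℤ)) m
      = Set.univ.pi fun i => Set.Ico ((2 : ℝ) ^ j * m i) ((2 : ℝ) ^ j * ((m i : ℝ) + 1)) := by
    ext z; simp [dyadicCube]
  rw [this, Real.volume_pi_Ico]
  have h : ∀ i, ENNReal.ofReal ((2 : ℝ) ^ j * ((m i : ℝ) + 1) - (2 : ℝ) ^ j * m i)
      = (2 : ℝ≥0∞) ^ j := by
    intro i
    rw [show (2 : ℝ) ^ j * ((m i : ℝ) + 1) - (2 : ℝ) ^ j * m i = 2 ^ j by ring,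
      ENNReal.ofReal_pow (by norm_num)]
    simp
  simp [h]

lemma volume_dyadicCube_rpow {d : ℕ} (j : ℕ) (m : Fin d → ℤ) (a : ℝ) :
    volume (dyadicCube (-(j : ℤ)) m) ^ a = (((2 : ℝ≥0∞) ^ d) ^ a) ^ j := by
  rw [volume_dyadicCube, ← pow_mul, mul_comm, pow_mul, ← ENNReal.rpow_natCast,
    ← ENNReal.rpow_natCast _ j, ← ENNReal.rpow_mul, ← ENNReal.rpow_mul, mul_comm]

lemma abs_sub_le_of_mem_cubeIndices {d : ℕ} {j : ℕ} {m k k' : Fin d → ℤ}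
    (hk : k ∈ cubeIndices j m) (hk' : k' ∈ cubeIndices j m) (i : Fin d) :
    |k i - k' i| ≤ 2 ^ j := by
  have key : ∀ l ∈ cubeIndices j m, (2 : ℝ) ^ j * (m i : ℝ) ≤ l i ∧
      (l i : ℝ) < (2 : ℝ) ^ j * ((m i : ℝ) + 1) := by
    intro l hl
    have hmem : (fun i => (l i : ℝ)) ∈ dyadicCube 0 l := by
      intro i; simp
    have := hl hmem i
    simpa using this
  have h1 := key k hk
  have h2 := key k' hk'
  have : |((k i - k' i : ℤ) : ℝ)| ≤ ((2 ^ j : ℤ) : ℝ) := by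
    push_cast
    rw [abs_le]
    constructor <;> linarith
  exact_mod_cast this

lemma cubeTerm_le_morreyENorm {d : ℕ} (u p : ℝ) (x : (Fin d → ℤ) → ℂ) (j : ℕ) (m : Fin d → ℤ) :
    cubeTerm u p x j m ≤ morreyENorm u p x :=
  le_iSup₂ (f := fun j m => cubeTerm u p x j m) j m

lemma cubeTerm_mono {d : ℕ} (u : ℝ) {p : ℝ} (hp : 0 < p) {x y : (Fin d → ℤ) → ℂ} {j : ℕ}
    {m : Fin d → ℤ} (h : ∀ k ∈ cubeIndices j m, ‖x k‖ₑ ≤ ‖y k‖ₑ) :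
    cubeTerm u p x j m ≤ cubeTerm u p y j m := by
  unfold cubeTerm
  gcongr with k
  exact h k k.2

lemma morreyENorm_mono {d : ℕ} (u : ℝ) {p : ℝ} (hp : 0 < p) {x y : (Fin d → ℤ) → ℂ}
    (h : ∀ k, ‖x k‖ₑ ≤ ‖y k‖ₑ) : morreyENorm u p x ≤ morreyENorm u p y :=
  iSup₂_mono fun _ _ => cubeTerm_mono u hp fun k _ => h k

/-- For `p < u` the exponent `1 / u - 1 / p` is negative, so in positive dimension this bound decays
geometrically in the level `j`. -/
lemma cubeTerm_le_mul_tsum {d : ℕ} (u : ℝ) {p : ℝ} (hp : 0 < p) (x : (Fin d → ℤ) → ℂ) (j : ℕ)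
    (m : Fin d → ℤ) :
    cubeTerm u p x j m ≤ (((2 : ℝ≥0∞) ^ d) ^ (1 / u - 1 / p)) ^ j *
      (∑' k, ‖x k‖ₑ ^ p) ^ (1 / p) := by
  unfold cubeTerm
  rw [volume_dyadicCube_rpow]
  gcongr
  exact ENNReal.tsum_comp_le_tsum_of_injective Subtype.val_injective fun k => ‖x k‖ₑ ^ p

lemma tsum_enorm_rpow_ne_top {d : ℕ} {p : ℝ} (hp : 0 < p) {x : (Fin d → ℤ) → ℂ}
    (hx : (Function.support x).Finite) : (∑' k, ‖x k‖ₑ ^ p) ^ (1 / p) ≠ ∞ := by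
  refine ENNReal.rpow_ne_top_of_nonneg (by positivity) ?_
  rw [tsum_eq_sum (s := hx.toFinset) (fun k hk => by
    simp only [Set.Finite.mem_toFinset, Function.mem_support, not_not] at hk
    simp [hk, hp])]
  exact ENNReal.sum_ne_top.2 fun k _ => ENNReal.rpow_ne_top_of_nonneg hp.le enorm_ne_top

lemma morreyENorm_lt_top_of_finite_support {d : ℕ} {u p : ℝ} (hp : 0 < p) (hpu : p < u)
    {x : (Fin d → ℤ) → ℂ} (hx : (Function.support x).Finite) : morreyENorm u p x < ∞ := by
  refine lt_of_le_of_lt ?_ (tsum_enorm_rpow_ne_top hp hx).lt_top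
  refine iSup₂_le fun j m => (cubeTerm_le_mul_tsum u hp x j m).trans ?_
  have h1 : ((2 : ℝ≥0∞) ^ d) ^ (1 / u - 1 / p) ≤ 1 := by
    refine ENNReal.rpow_le_one_of_one_le_of_neg (one_le_pow₀ (by norm_num)) ?_
    have := one_div_lt_one_div_of_lt hp hpu
    linarith
  exact mul_le_of_le_one_left (by positivity) (pow_le_one₀ (by positivity) h1)

/-- Sequences vanishing on a suitable finite set do not interact with a given finite sequence:
small cubes cannot meet both supports, while on large cubes the finite sequence is negligible. -/
lemma exists_finset_morreyENorm_add_le_two {d : ℕ} {u p : ℝ} (hp : 1 ≤ p) (hpu : p < u)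
    {z : (Fin d → ℤ) → ℂ} (hz : (Function.support z).Finite) (hz2 : morreyENorm u p z ≤ 2) :
    ∃ F : Finset (Fin d → ℤ), ∀ x : (Fin d → ℤ) → ℂ, (∀ k ∈ F, x k = 0) →
      morreyENorm u p x ≤ 1 → morreyENorm u p (z + x) ≤ 2 := by
  have hp0 : 0 < p := by linarith
  rcases Nat.eq_zero_or_pos d with rfl | hd
  -- In dimension 0 the ratio below equals 1 and nothing decays, but there is only one index, so
  -- removing it forces `x = 0`.
  · refine ⟨Finset.univ, fun x hx _ => ?_⟩
    have : x = 0 := funext fun k => hx k (Finset.mem_univ k)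
    simpa [this] using hz2
  have hr : ((2 : ℝ≥0∞) ^ d) ^ (1 / u - 1 / p) < 1 := by
    refine ENNReal.rpow_lt_one_of_one_lt_of_neg (one_lt_pow₀ (by norm_num) hd.ne') ?_
    have := one_div_lt_one_div_of_lt hp0 hpu
    linarith
  have hlim := ENNReal.Tendsto.mul_const (ENNReal.tendsto_pow_atTop_nhds_zero_of_lt_one hr)
    (Or.inr (tsum_enorm_rpow_ne_top hp0 hz))
  rw [zero_mul] at hlim
  -- From level `N` on, `z` contributes at most 1 to a cube, which leaves room for the 1 contributed
  -- by `x`.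
  obtain ⟨N, hN⟩ := eventually_atTop.1 (hlim.eventually (gt_mem_nhds (zero_lt_one)))
  -- These boxes contain every index of a cube of level at most `N` that meets the support of `z`.
  have hfin : (⋃ k ∈ Function.support z,
      Set.Icc (fun i => k i - 2 ^ N) (fun i => k i + 2 ^ N)).Finite :=
    hz.biUnion fun k _ => Set.finite_Icc _ _
  refine ⟨hfin.toFinset, fun x hx hx1 => iSup₂_le fun j m => ?_⟩
  by_cases hQ : ∃ k ∈ cubeIndices j m, z k ≠ 0
  · obtain ⟨k, hk, hzk⟩ := hQ
    rcases le_total j N with hj | hj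
    · refine (cubeTerm_mono u hp0 fun k' hk' => ?_).trans
        ((cubeTerm_le_morreyENorm u p z j m).trans hz2)
      have : x k' = 0 := by
        refine hx k' (hfin.mem_toFinset.2 (Set.mem_biUnion hzk ?_))
        have h2 : (2 : ℤ) ^ j ≤ 2 ^ N := pow_le_pow_right₀ (by norm_num) hj
        constructor <;> intro i <;>
          have := abs_le.1 (abs_sub_le_of_mem_cubeIndices hk hk' i) <;> simp only <;> linarith
      simp [this]
    · refine (cubeTerm_add_le u hp z x j m).trans ?_
      calc _ ≤ (1 : ℝ≥0∞) + 1 := add_le_add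
              ((cubeTerm_le_mul_tsum u hp0 z j m).trans (hN j hj).le)
              ((cubeTerm_le_morreyENorm u p x j m).trans hx1)
        _ = 2 := by norm_num
  · push Not at hQ
    calc cubeTerm u p (z + x) j m ≤ cubeTerm u p x j m :=
          cubeTerm_mono u hp0 fun k hk => by simp [hQ k hk]
      _ ≤ 1 := (cubeTerm_le_morreyENorm u p x j m).trans hx1
      _ ≤ 2 := by norm_num

end MorreySequence

/-! ### Operators on spaces whose tails are almost disjoint -/

section Tails

variable {X ι α : Type*} [NormedAddCommGroup X] [NormedSpace ℂ X]
  {S : Finset ι → Submodule ℂ X}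

/-- A continuous functional is small on the tails `S F` if tails can be added to elements of
`S ∅` without leaving the ball of radius `2`. -/
lemma exists_finset_norm_functional_le (hS : Antitone S)
    (hadd : ∀ z ∈ S ∅, ‖z‖ ≤ 2 → ∃ F, ∀ x ∈ S F, ‖x‖ ≤ 1 → ‖z + x‖ ≤ 2)
    (f : X →L[ℂ] ℂ) {ε : ℝ} (hε : 0 < ε) : ∃ F, ∀ x ∈ S F, ‖x‖ ≤ 1 → ‖f x‖ ≤ ε := by
  by_contra! hf
  have hsum : ∀ n : ℕ, ∃ z ∈ S ∅, ‖z‖ ≤ 2 ∧ n * ε ≤ (f z).re := by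
    intro n
    induction n with
    | zero => exact ⟨0, zero_mem _, by simp, by simp⟩
    | succ n ih =>
      obtain ⟨z, hz, hz2, hfz⟩ := ih
      obtain ⟨F, hF⟩ := hadd z hz hz2
      obtain ⟨x, hx, hx1, hfx⟩ := hf F
      -- Rotating the phase makes the new value positive, so the contributions add up in the real
      -- part without cancellation.
      obtain ⟨c, hc, hcx⟩ : ∃ c : ℂ, ‖c‖ = 1 ∧ c * f x = (‖f x‖ : ℂ) := by
        have h0 : (‖f x‖ : ℂ) ≠ 0 := by
          exact_mod_cast (hε.trans hfx).ne'
        refine ⟨(starRingEnd ℂ) (f x) / ‖f x‖, ?_, ?_⟩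
        · simp only [norm_div, RCLike.norm_conj, Complex.norm_real, norm_norm]
          exact div_self (hε.trans hfx).ne'
        · rw [div_mul_eq_mul_div, Complex.conj_mul', sq, mul_div_assoc, div_self h0, mul_one]
      refine ⟨z + c • x, add_mem hz ((S ∅).smul_mem c (hS (Finset.empty_subset F) hx)),
        hF _ ((S F).smul_mem c hx) (by rwa [norm_smul, hc, one_mul]), ?_⟩
      rw [map_add, map_smul, smul_eq_mul, hcx, Complex.add_re, Complex.ofReal_re]
      push_cast
      linarith
  obtain ⟨n, hn⟩ := exists_nat_gt (‖f‖ * 2 / ε)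
  obtain ⟨z, -, hz2, hfz⟩ := hsum n
  have h1 : (f z).re ≤ ‖f‖ * 2 :=
    (Complex.re_le_norm _).trans ((f.le_opNorm z).trans (by gcongr))
  rw [div_lt_iff₀ hε] at hn
  linarith

variable [DecidableEq α] {q : ℝ≥0∞}
variable {E : α → Type*} [∀ i, NormedAddCommGroup (E i)]

lemma lp.norm_rpow_eq_add (hq : 0 < q.toReal) (y : lp E q) (G : Finset α) :
    ‖y‖ ^ q.toReal = ‖∑ i ∈ G, lp.single q i (y i)‖ ^ q.toReal +
      ‖y - ∑ i ∈ G, lp.single q i (y i)‖ ^ q.toReal := by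
  rw [lp.norm_compl_sum_single hq, lp.norm_sum_single hq]
  ring

variable [Fact (1 ≤ q)]

/-- Adding a vector of norm at least `ε` which is coordinatewise small increases the `q`-th power
of the norm in `ℓ_q` by a definite amount. -/
lemma lp.exists_finset_norm_rpow_add_le_norm_add_rpow (hq : q ≠ ∞) (y : lp E q)
    {ε : ℝ} (hε : 0 < ε) :
    ∃ (G : Finset α) (η : ℝ), 0 < η ∧ ∀ w : lp E q, (∀ i ∈ G, ‖w i‖ ≤ η) →
      ε ≤ ‖w‖ → ‖y‖ ^ q.toReal + ε ^ q.toReal / 2 ≤ ‖y + w‖ ^ q.toReal := by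
  have hq0 : 0 < q := zero_lt_one.trans_le Fact.out
  have hq' : 0 < q.toReal := ENNReal.toReal_pos hq0.ne' hq
  -- Each loss `2 * δ` combines the part of `y` outside `G` with the part of `w` inside `G`, both of
  -- norm at most `δ`.
  have hcont : Continuous fun δ : ℝ =>
      (max (‖y‖ - 2 * δ) 0) ^ q.toReal + (max (ε - 2 * δ) 0) ^ q.toReal := by
    fun_prop (disch := exact hq'.le)
  have h0 := hcont.tendsto 0
  simp only [mul_zero, sub_zero, max_eq_left (norm_nonneg y), max_eq_left hε.le] at h0
  have hlt : ‖y‖ ^ q.toReal + ε ^ q.toReal / 2 < ‖y‖ ^ q.toReal + ε ^ q.toReal := by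
    have := Real.rpow_pos_of_pos hε q.toReal
    linarith
  obtain ⟨δ, hδ, hδ0⟩ := (((h0.mono_left nhdsWithin_le_nhds).eventually (lt_mem_nhds hlt)).and
    (self_mem_nhdsWithin (s := Set.Ioi (0 : ℝ)))).exists
  have hδ0 : 0 < δ := hδ0
  obtain ⟨G, hG⟩ := ((Metric.tendsto_nhds.1 (lp.hasSum_single hq y)) δ hδ0).exists
  rw [dist_comm, dist_eq_norm] at hG
  -- The `+ 1` covers an empty `G`.
  refine ⟨G, δ / (G.card + 1), by positivity, fun w hw hεw => hδ.le.trans ?_⟩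
  have hPw : ‖∑ i ∈ G, lp.single q i (w i)‖ ≤ δ := by
    calc _ ≤ ∑ i ∈ G, ‖lp.single q i (w i)‖ := norm_sum_le _ _
      _ ≤ ∑ i ∈ G, δ / (G.card + 1) := Finset.sum_le_sum fun i hi =>
          (lp.norm_single hq0 i (w i)).le.trans (hw i hi)
      _ = δ * (G.card / (G.card + 1)) := by rw [Finset.sum_const, nsmul_eq_mul]; ring
      _ ≤ δ * 1 := by
          gcongr
          rw [div_le_one (by positivity)]; linarith
      _ = δ := mul_one δ
  rw [lp.norm_rpow_eq_add hq' (y + w) G]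
  have hadd : ∑ i ∈ G, lp.single q i ((y + w) i)
      = ∑ i ∈ G, lp.single q i (y i) + ∑ i ∈ G, lp.single q i (w i) := by
    rw [← Finset.sum_add_distrib]
    exact Finset.sum_congr rfl fun i _ => lp.single_add q i (y i) (w i)
  rw [hadd]
  set Py := ∑ i ∈ G, lp.single q i (y i)
  set Pw := ∑ i ∈ G, lp.single q i (w i)
  gcongr
  · refine max_le ?_ (norm_nonneg _)
    have : ‖y‖ ≤ ‖Py + Pw‖ + ‖Pw‖ + ‖y - Py‖ := by
      calc ‖y‖ = ‖(Py + Pw) - Pw + (y - Py)‖ := by congr 1; abel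
        _ ≤ _ := (norm_add_le _ _).trans (by gcongr; exact norm_sub_le _ _)
    linarith
  · refine max_le ?_ (norm_nonneg _)
    have : ‖w‖ ≤ ‖y + w - (Py + Pw)‖ + ‖Pw‖ + ‖y - Py‖ := by
      calc ‖w‖ = ‖(y + w - (Py + Pw)) + Pw - (y - Py)‖ := by congr 1; abel
        _ ≤ _ := (norm_sub_le _ _).trans (by gcongr; exact norm_add_le _ _)
    linarith

/-- A continuous operator into `ℓ_q` is small on the tails `S F` if tails can be added to elements
of `S ∅` without leaving the ball of radius `2`. -/
lemma exists_finset_norm_apply_le [DecidableEq ι] (hS : Antitone S)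
    (hadd : ∀ z ∈ S ∅, ‖z‖ ≤ 2 → ∃ F, ∀ x ∈ S F, ‖x‖ ≤ 1 → ‖z + x‖ ≤ 2) (hq : q ≠ ∞)
    (T : X →L[ℂ] lp (fun _ : α => ℂ) q) {ε : ℝ} (hε : 0 < ε) :
    ∃ F, ∀ x ∈ S F, ‖x‖ ≤ 1 → ‖T x‖ ≤ ε := by
  have hq' : 0 < q.toReal := ENNReal.toReal_pos (zero_lt_one.trans_le Fact.out).ne' hq
  by_contra! hT
  have hsum : ∀ n : ℕ, ∃ z ∈ S ∅, ‖z‖ ≤ 2 ∧ n * (ε ^ q.toReal / 2) ≤ ‖T z‖ ^ q.toReal := by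
    intro n
    induction n with
    | zero => exact ⟨0, zero_mem _, by simp, by simp [Real.zero_rpow hq'.ne']⟩
    | succ n ih =>
      obtain ⟨z, hz, hz2, hTz⟩ := ih
      obtain ⟨F, hF⟩ := hadd z hz hz2
      obtain ⟨G, η, hη, hG⟩ := lp.exists_finset_norm_rpow_add_le_norm_add_rpow hq (T z) hε
      have hcoord : ∀ i, ∃ F, ∀ x ∈ S F, ‖x‖ ≤ 1 → ‖T x i‖ ≤ η := fun i =>
        exists_finset_norm_functional_le hS hadd ((lp.evalCLM ℂ (fun _ : α => ℂ) q i).comp T) hη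
      choose F' hF' using hcoord
      -- One tail serves both purposes: `F` keeps the sum in the ball, and the sets `F' i` make the
      -- coordinates of `T x` in `G` small.
      obtain ⟨x, hx, hx1, hTx⟩ := hT (F ∪ G.biUnion F')
      refine ⟨z + x, add_mem hz (hS (Finset.empty_subset _) hx),
        hF x (hS Finset.subset_union_left hx) hx1, ?_⟩
      have := hG (T x) (fun i hi => hF' i x (hS ((Finset.subset_biUnion_of_mem F' hi).trans
        Finset.subset_union_right) hx) hx1) hTx.le
      rw [map_add]
      push_cast
      linarith
  have hε' : 0 < ε ^ q.toReal / 2 := by positivity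
  obtain ⟨n, hn⟩ := exists_nat_gt ((‖T‖ * 2) ^ q.toReal / (ε ^ q.toReal / 2))
  obtain ⟨z, -, hz2, hTz⟩ := hsum n
  have h1 : ‖T z‖ ^ q.toReal ≤ (‖T‖ * 2) ^ q.toReal := by
    gcongr
    exact (T.le_opNorm z).trans (by gcongr)
  rw [div_lt_iff₀ hε'] at hn
  linarith

end Tails

/-! ### Finite-rank operators and norm limits of compact operators -/

/-- Each summand factors through `ℂ`, whose identity is compact. -/
lemma isCompactOperator_sum_smulRight {ι X Y : Type*} [NormedAddCommGroup X] [NormedSpace ℂ X]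
    [NormedAddCommGroup Y] [NormedSpace ℂ Y] (s : Finset ι) (f : ι → X →L[ℂ] ℂ) (y : ι → Y) :
    IsCompactOperator (∑ i ∈ s, (f i).smulRight (y i) : X →L[ℂ] Y) := by
  refine Submodule.sum_mem (compactOperator (RingHom.id ℂ) X Y) fun i _ => ?_
  exact (isCompactOperator_id.comp_clm (f i)).clm_comp
    (ContinuousLinearMap.toSpanSingleton ℂ (y i))

lemma isCompactOperator_of_forall_exists_norm_sub_le {X Y : Type*} [NormedAddCommGroup X]
    [NormedSpace ℂ X] [NormedAddCommGroup Y] [NormedSpace ℂ Y] [CompleteSpace Y] (T : X →L[ℂ] Y)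
    (h : ∀ ε > 0, ∃ R : X →L[ℂ] Y, IsCompactOperator R ∧ ‖T - R‖ ≤ ε) : IsCompactOperator T := by
  choose! R hR hTR using h
  refine isCompactOperator_of_tendsto (l := 𝓝[>] (0 : ℝ)) (F := R) ?_
    (eventually_mem_nhdsWithin.mono hR)
  rw [tendsto_iff_norm_sub_tendsto_zero]
  refine squeeze_zero' (.of_forall fun _ => norm_nonneg _)
    (eventually_mem_nhdsWithin.mono fun ε hε => ?_) (tendsto_id.mono_left nhdsWithin_le_nhds)
  rw [norm_sub_rev]
  exact hTR ε hε

noncomputable section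
namespace MorreySequence

variable {d : ℕ} {u p : ℝ} [hp : Fact (1 ≤ p)]

/-! ### Tails and coordinate truncations in `m_{u,p}^{00}` -/

variable (d u p) in
/-- The finite sequences vanishing on `F`, as a subspace of `m_{u,p}^{00}(ℤ^d)`. -/
def tailSubmodule (F : Finset (Fin d → ℤ)) : Submodule ℂ (closureFinite d u p) where
  carrier := {x | x.1 ∈ finiteSeq d u p ∧ ∀ k ∈ F, x.1.toSeq k = 0}
  add_mem' {x y} hx hy := ⟨add_mem hx.1 hy.1, fun k hk => by simp [hx.2 k hk, hy.2 k hk]⟩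
  zero_mem' := ⟨zero_mem _, fun k _ => by simp⟩
  smul_mem' c x hx := ⟨Submodule.smul_mem _ c hx.1, fun k hk => by simp [hx.2 k hk]⟩

lemma tailSubmodule_antitone : Antitone (tailSubmodule d u p) :=
  fun _ _ hFG _ hx => ⟨hx.1, fun k hk => hx.2 k (hFG hk)⟩

lemma MorreySpace.norm_le_iff (x : MorreySpace d u p) {c : ℝ≥0∞} (hc : c ≠ ∞) :
    ‖x‖ ≤ c.toReal ↔ morreyENorm u p x.toSeq ≤ c := by
  rw [MorreySpace.norm_def, ENNReal.toReal_le_toReal x.morreyENorm_lt_top.ne hc]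

lemma MorreySpace.norm_coord_le (x : MorreySpace d u p) (k : Fin d → ℤ) : ‖x.toSeq k‖ ≤ ‖x‖ := by
  rw [MorreySpace.norm_def, ← toReal_enorm]
  exact ENNReal.toReal_mono x.morreyENorm_lt_top.ne (enorm_le_morreyENorm u hp.out _ k)

lemma exists_finset_norm_add_le_two (hpu : p < u) (z : closureFinite d u p)
    (hz : z ∈ tailSubmodule d u p ∅) (hz2 : ‖z‖ ≤ 2) :
    ∃ F, ∀ x ∈ tailSubmodule d u p F, ‖x‖ ≤ 1 → ‖z + x‖ ≤ 2 := by
  have h2 : (2 : ℝ) = (2 : ℝ≥0∞).toReal := by simp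
  have h1 : (1 : ℝ) = (1 : ℝ≥0∞).toReal := by simp
  rw [h2, Submodule.coe_norm, MorreySpace.norm_le_iff _ (by simp)] at hz2
  obtain ⟨F, hF⟩ := exists_finset_morreyENorm_add_le_two hp.out hpu hz.1 hz2
  refine ⟨F, fun x hx hx1 => ?_⟩
  rw [h1, Submodule.coe_norm, MorreySpace.norm_le_iff _ (by simp)] at hx1
  rw [h2, Submodule.coe_norm, MorreySpace.norm_le_iff _ (by simp)]
  simpa using hF x.1.toSeq hx.2 hx1

variable (u p) in
/-- The `k`-th coordinate functional on `m_{u,p}^{00}(ℤ^d)`. -/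
def coordCLM (k : Fin d → ℤ) : closureFinite d u p →L[ℂ] ℂ :=
  ((LinearMap.proj k ∘ₗ MorreySpace.toSeq) ∘ₗ (closureFinite d u p).subtype).mkContinuous 1
    fun x => by simpa using MorreySpace.norm_coord_le x.1 k

lemma coordCLM_apply (k : Fin d → ℤ) (x : closureFinite d u p) :
    coordCLM u p k x = x.1.toSeq k := rfl

/-- The `k`-th unit sequence as an element of `m_{u,p}^{00}(ℤ^d)`. -/
def unitSeq (hpu : p < u) (k : Fin d → ℤ) : closureFinite d u p :=
  have hfin : (Function.support (Pi.single k 1 : (Fin d → ℤ) → ℂ)).Finite :=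
    (Set.finite_singleton k).subset Pi.support_single_subset
  ⟨(⟨Pi.single k 1, morreyENorm_lt_top_of_finite_support (zero_lt_one.trans_le hp.out) hpu hfin⟩ :
    morreySubmodule d u p), Submodule.le_topologicalClosure _ hfin⟩

lemma toSeq_unitSeq (hpu : p < u) (k : Fin d → ℤ) :
    (unitSeq hpu k : closureFinite d u p).1.toSeq = Pi.single k 1 := rfl

/-- Restriction of sequences to a finite set of indices. -/
def truncCLM (hpu : p < u) (F : Finset (Fin d → ℤ)) :
    closureFinite d u p →L[ℂ] closureFinite d u p :=
  ∑ k ∈ F, (coordCLM u p k).smulRight (unitSeq hpu k)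

lemma toSeq_truncCLM (hpu : p < u) (F : Finset (Fin d → ℤ)) (x : closureFinite d u p)
    (l : Fin d → ℤ) : (truncCLM hpu F x).1.toSeq l = if l ∈ F then x.1.toSeq l else 0 := by
  simp [truncCLM, toSeq_unitSeq, coordCLM_apply, Pi.single_apply]

lemma toSeq_sub_truncCLM (hpu : p < u) (F : Finset (Fin d → ℤ)) (x : closureFinite d u p)
    (k : Fin d → ℤ) :
    (x - truncCLM hpu F x).1.toSeq k = if k ∈ F then 0 else x.1.toSeq k := by
  rw [Submodule.coe_sub, map_sub, Pi.sub_apply, toSeq_truncCLM]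
  split_ifs <;> simp

lemma norm_sub_truncCLM_le (hpu : p < u) (F : Finset (Fin d → ℤ)) (x : closureFinite d u p) :
    ‖x - truncCLM hpu F x‖ ≤ ‖x‖ := by
  refine ENNReal.toReal_mono x.1.morreyENorm_lt_top.ne
    (morreyENorm_mono u (zero_lt_one.trans_le hp.out) fun k => ?_)
  change ‖(x - truncCLM hpu F x).1.toSeq k‖ₑ ≤ ‖x.1.toSeq k‖ₑ
  rw [toSeq_sub_truncCLM]
  split_ifs <;> simp

lemma sub_truncCLM_mem_tailSubmodule (hpu : p < u) (F : Finset (Fin d → ℤ))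
    {x : closureFinite d u p} (hx : x ∈ tailSubmodule d u p ∅) :
    x - truncCLM hpu F x ∈ tailSubmodule d u p F := by
  refine ⟨Set.Finite.subset hx.1 fun k hk => ?_, fun k hk => by rw [toSeq_sub_truncCLM, if_pos hk]⟩
  rw [Function.mem_support, toSeq_sub_truncCLM] at hk
  rw [Function.mem_support]
  split_ifs at hk with h
  · exact absurd rfl hk
  · exact hk

lemma dense_tailSubmodule_empty :
    Dense (tailSubmodule d u p ∅ : Set (closureFinite d u p)) := by
  intro x
  rw [closure_subtype]
  have hx : x.1 ∈ closure (finiteSeq d u p : Set (MorreySpace d u p)) := x.2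
  refine closure_mono (fun y hy => ?_) hx
  exact ⟨⟨y, Submodule.le_topologicalClosure _ hy⟩, ⟨hy, by simp⟩, rfl⟩

lemma isCompactOperator_comp_truncCLM (hpu : p < u) {Y : Type*} [NormedAddCommGroup Y]
    [NormedSpace ℂ Y] (T : closureFinite d u p →L[ℂ] Y) (F : Finset (Fin d → ℤ)) :
    IsCompactOperator (T ∘L truncCLM hpu F) :=
  (isCompactOperator_sum_smulRight F (coordCLM u p) (unitSeq hpu)).clm_comp T

/-- The complementary truncation is a contraction sending finite sequences into the tail. The bound
is a closed condition, so it passes from the dense finite sequences to the whole space. -/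
lemma norm_sub_comp_truncCLM_le (hpu : p < u) {Y : Type*} [NormedAddCommGroup Y]
    [NormedSpace ℂ Y] (T : closureFinite d u p →L[ℂ] Y) {F : Finset (Fin d → ℤ)} {ε : ℝ}
    (hε : 0 ≤ ε) (hF : ∀ x ∈ tailSubmodule d u p F, ‖x‖ ≤ 1 → ‖T x‖ ≤ ε) :
    ‖T - T ∘L truncCLM hpu F‖ ≤ ε := by
  have htail : ∀ x ∈ tailSubmodule d u p F, ‖T x‖ ≤ ε * ‖x‖ := by
    intro x hx
    rcases eq_or_ne x 0 with rfl | hx0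
    · simp
    have hn : 0 < ‖x‖ := norm_pos_iff.2 hx0
    have := hF ((‖x‖⁻¹ : ℂ) • x) (Submodule.smul_mem _ _ hx) (by
      rw [norm_smul, norm_inv, Complex.norm_real, norm_norm, inv_mul_cancel₀ hn.ne'])
    rw [map_smul, norm_smul, norm_inv, Complex.norm_real, norm_norm,
      inv_mul_le_iff₀ hn] at this
    linarith
  refine ContinuousLinearMap.opNorm_le_bound _ hε fun x => ?_
  refine dense_tailSubmodule_empty.induction (P := fun x => ‖(T - T ∘L truncCLM hpu F) x‖ ≤ ε * ‖x‖)
    (fun x hx => ?_) (isClosed_le (by fun_prop) (by fun_prop)) x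
  have h : (T - T ∘L truncCLM hpu F) x = T (x - truncCLM hpu F x) := by simp
  rw [h]
  exact (htail _ (sub_truncCLM_mem_tailSubmodule hpu F hx)).trans
    (by gcongr; exact norm_sub_truncCLM_le hpu F x)

end MorreySequence

end

theorem theorem4p2 (d : ℕ) (u p : ℝ) (q : ℝ≥0∞) [Fact (1 ≤ p)] [Fact (1 ≤ q)]
    (hp : 1 < p) (hpu : p < u) (hq : q < ∞)
    (T : MorreySequence.closureFinite d u p →L[ℂ] lp (fun _ : Fin d → ℤ => ℂ) q) :
    IsCompactOperator T := by
  refine isCompactOperator_of_forall_exists_norm_sub_le T fun ε hε => ?_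
  obtain ⟨F, hF⟩ := exists_finset_norm_apply_le MorreySequence.tailSubmodule_antitone
    (MorreySequence.exists_finset_norm_add_le_two hpu) hq.ne T hε
  exact ⟨T ∘L MorreySequence.truncCLM hpu F,
    MorreySequence.isCompactOperator_comp_truncCLM hpu T F,
    MorreySequence.norm_sub_comp_truncCLM_le hpu T hε.le hF⟩
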